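/- **Setting.** Let $q\in\mathbb N$, $n\in\mathbb N_0$, let $a<b$ be real, and let $s_0,s_1,\dots,s_m$ be complex $q\times q$ matrices, where $m=2n$ or $m=2n+1$. Put $$\widehat s_k:=-ab\,s_k+(a+b)s_{k+1}-s_{k+2},$$ and define the block matrices $$H_{1,j}:=(s_{l+k})_{l,k=0}^{j},\qquad H_{2,j}:=(\widehat s_{l+k})_{l,k=0}^{j},\qquad K_{1,j}:=(b s_{l+k}-s_{l+k+1})_{l,k=0}^{j},\qquad K_{2,j}:=(-a s_{l+k}+s_{l+k+1})_{l,k=0}^{j}.$$ Assume that $(s_k)_{k=0}^m$ is Hausdorff positive definite on $[a,b]$: if $m=2n$, then $H_{1,n}$ and (for $n\ge1$) $H_{2,n-1}$ are positive definite; if $m=2n+1$, then $K_{1,n}$ and $K_{2,n}$ are positive definite. **Auxiliary matrices.** Let $T_j$ be the $(j+1)q\times(j+1)q$ block matrix with blocks $I_q$ on the first block subdiagonal and zeros elsewhere, and let $R_j(z):=(I-zT_j)^{-1}$. Let $v_j:=(I_q,0,\dots,0)^{T}$ (block column with $j+1$ blocks). Let $$u_{2,j}:=\begin{pmatrix}-(a+b)s_0+s_1\\-\widehat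 s_0\\ \vdots\\-\widehat s_{j-1}\end{pmatrix},\qquad \widetilde u_{1,j}:=\begin{pmatrix}s_0\\ s_1-bs_0\\ \vdots\\ s_j-bs_{j-1}\end{pmatrix},\qquad Y_{2,j}:=\begin{pmatrix}\widehat s_j\\ \vdots\\ \widehat s_{2j-1}\end{pmatrix},\qquad \widetilde Y_{1,j}:=\begin{pmatrix}bs_j-s_{j+1}\\ \vdots\\ bs_{2j-1}-s_{2j}\end{pmatrix}.$$ **Polynomials.** For $j\ge1$ let $$P_{2,j}(z):=(-Y_{2,j}^*H_{2,j-1}^{-1},I_q)R_j(z)v_j,\qquad Q_{2,j}(z):=-(-Y_{2,j}^*H_{2,j-1}^{-1},I_q)R_j(z)(u_{2,j}+zv_js_0),$$ $$\Gamma_{1,j}(z):=(-\widetilde Y_{1,j}^*K_{1,j-1}^{-1},I_q)R_j(z)v_j,\qquad \Theta_{1,j}(z):=(-\widetilde Y_{1,j}^*K_{1,j-1}^{-1},I_q)R_j(z)\widetilde u_{1,j},$$ and let $P_{2,0}:=I_q$, $Q_{2,0}(z):=-(u_{2,0}+zs_0)$, $\Gamma_{1,0}:=I_q$, $\Theta_{1,0}:=s_0$.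 **Parameters.** For $0\le j\le n-1$ let $$\mathbf t_j:=v_j^*R_j(a)^*K_{1,j}^{-1}R_j(a)v_j,\qquad \mathbf w_j:=(u_{2,j}^*+as_0v_j^*)R_j(a)^*H_{2,j}^{-1}R_j(a)(u_{2,j}+av_js_0).$$ The Dyukarev–Stieltjes matrix (DSM) parameters are $\mathbf m_0:=\mathbf t_0$, $\mathbf l_0:=\mathbf w_0$, and $\mathbf m_j:=\mathbf t_j-\mathbf t_{j-1}$, $\mathbf l_j:=\mathbf w_j-\mathbf w_{j-1}$ for $1\le j\le n-1$. **Claim.** The matrices $\mathbf m_j$ and $\mathbf l_j$, $0\le j\le n-1$, are invertible, and $$Q_{2,j}(a)=(-1)^j\,\mathbf m_0^{-1}\mathbf l_0^{-1}\mathbf m_1^{-1}\mathbf l_1^{-1}\cdots\mathbf l_{j-1}^{-1}\mathbf m_j^{-1},\qquad 0\le j\le n-1,$$ $$\Gamma_{1,j}(a)=(-1)^j\,\mathbf m_0^{-1}\mathbf l_0^{-1}\mathbf m_1^{-1}\mathbf l_1^{-1}\cdots\mathbf m_{j-1}^{-1}\mathbf l_{j-1}^{-1},\qquad 1\le j\le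 n,$$ $$P_{2,j}(a)=(-1)^j\,\mathbf m_0^{-1}\mathbf l_0^{-1}\cdots\mathbf l_{j-1}^{-1}\mathbf m_j^{-1}\,(\mathbf m_0+\mathbf m_1+\cdots+\mathbf m_j),\qquad 1\le j\le n-1,$$ $$\Theta_{1,j}(a)=(-1)^j\,\mathbf m_0^{-1}\mathbf l_0^{-1}\cdots\mathbf m_{j-1}^{-1}\mathbf l_{j-1}^{-1}\,(s_0+\mathbf l_0+\cdots+\mathbf l_{j-1}),\qquad 1\le j\le n.$$ -/

import Mathlib

open scoped Matrix ComplexOrder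

noncomputable section

namespace HausdorffMoment

/-- Complex `q × q` matrices. -/
abbrev Mat (q : ℕ) := Matrix (Fin q) (Fin q) ℂ

/-- Square block matrices with `k × k` blocks of size `q × q`. -/
abbrev BlockMat (k q : ℕ) := Matrix (Fin k × Fin q) (Fin k × Fin q) ℂ

/-- Block columns consisting of `k` blocks of size `q × q`. -/
abbrev BlockCol (k q : ℕ) := Matrix (Fin k × Fin q) (Fin q) ℂ

/-- Block rows consisting of `k` blocks of size `q × q`. -/
abbrev BlockRow (k q : ℕ) := Matrix (Fin q) (Fin k × Fin q) ℂ

variable {q : ℕ}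

/-- The block Hankel matrix `(f (l + k))` for `0 ≤ l, k ≤ j`. -/
def blockHankel (f : ℕ → Mat q) (j : ℕ) : BlockMat (j + 1) q :=
  Matrix.of fun x y => f (x.1 + y.1) x.2 y.2

/-- The block column with the `k` blocks `f i, f (i + 1), …, f (i + k - 1)`. -/
def blockCol (f : ℕ → Mat q) (i k : ℕ) : BlockCol k q :=
  Matrix.of fun x β => f (i + x.1) x.2 β

/-- The block column with the block `A` on top of the block column `B`. -/
def colCons {k : ℕ} (A : Mat q) (B : BlockCol k q) : BlockCol (k + 1) q :=
  Matrix.of fun x β => (Fin.cons (A x.2 β) (fun i => B (i, x.2) β) : Fin (k + 1) → ℂ) x.1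

/-- The block row `(A, B)` with the block `B` as its last entry. -/
def rowSnoc {k : ℕ} (A : BlockRow k q) (B : Mat q) : BlockRow (k + 1) q :=
  Matrix.of fun α x => (Fin.snoc (fun i => A α (i, x.2)) (B α x.2) : Fin (k + 1) → ℂ) x.1

/-- `T_j`: identity blocks on the first block subdiagonal, zero elsewhere. -/
def T (q j : ℕ) : BlockMat (j + 1) q :=
  Matrix.of fun x y => if (x.1 : ℕ) = y.1 + 1 ∧ x.2 = y.2 then 1 else 0

/-- `R_j(z) = (I - z T_j)⁻¹`; the matrix `I - z T_j` is unipotent, hence invertible. -/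
def R (q j : ℕ) (z : ℂ) : BlockMat (j + 1) q := (1 - z • T q j)⁻¹

/-- `v_j`: the block column `(I_q, 0, …, 0)`. -/
def v (q j : ℕ) : BlockCol (j + 1) q := colCons 1 0

/-- `ŝ_k = -ab s_k + (a+b) s_{k+1} - s_{k+2}`. -/
def sHat (a b : ℝ) (s : ℕ → Mat q) (k : ℕ) : Mat q :=
  -((a * b : ℂ) • s k) + (a + b : ℂ) • s (k + 1) - s (k + 2)

/-- `H_{1,j}`. -/
def H₁ (s : ℕ → Mat q) (j : ℕ) : BlockMat (j + 1) q := blockHankel s j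

/-- `H_{2,j}`. -/
def H₂ (a b : ℝ) (s : ℕ → Mat q) (j : ℕ) : BlockMat (j + 1) q :=
  -((a * b : ℂ) • blockHankel s j) + (a + b : ℂ) • blockHankel (fun k => s (k + 1)) j
    - blockHankel (fun k => s (k + 2)) j

/-- `K_{1,j}`. -/
def K₁ (b : ℝ) (s : ℕ → Mat q) (j : ℕ) : BlockMat (j + 1) q :=
  (b : ℂ) • blockHankel s j - blockHankel (fun k => s (k + 1)) j

/-- `K_{2,j}`. -/
def K₂ (a : ℝ) (s : ℕ → Mat q) (j : ℕ) : BlockMat (j + 1) q :=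
  -((a : ℂ) • blockHankel s j) + blockHankel (fun k => s (k + 1)) j

/-- The finite sequence `s_0, …, s_m` is Hausdorff positive definite on `[a,b]`: if `m = 2j`, then
`H_{1,j}` and `H_{2,j-1}` are positive definite (the latter being void for `j = 0`); if
`m = 2j + 1`, then `K_{1,j}` and `K_{2,j}` are positive definite. Only `s_0, …, s_m` enter. -/
def IsHausdorffPosDef (a b : ℝ) (s : ℕ → Mat q) (m : ℕ) : Prop :=
  (∀ j, m = 2 * j → (H₁ s j).PosDef) ∧
  (∀ j, m = 2 * (j + 1) → (H₂ a b s j).PosDef) ∧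
  (∀ j, m = 2 * j + 1 → (K₁ b s j).PosDef ∧ (K₂ a s j).PosDef)

/-- `Ỹ_{1,j} = b y_{[j,2j-1]} - y_{[j+1,2j]}`. -/
def Y₁tilde (b : ℝ) (s : ℕ → Mat q) (j : ℕ) : BlockCol j q :=
  (b : ℂ) • blockCol s j j - blockCol s (j + 1) j

/-- `Y_{2,j} = ŷ_{[j,2j-1]}`. -/
def Y₂ (a b : ℝ) (s : ℕ → Mat q) (j : ℕ) : BlockCol j q := blockCol (sHat a b s) j j

/-- `ũ_{1,j} = y_{[0,j]} - b (0, y_{[0,j-1]})`, so that `ũ_{1,0} = s_0`. -/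
def u₁tilde (b : ℝ) (s : ℕ → Mat q) (j : ℕ) : BlockCol (j + 1) q :=
  blockCol s 0 (j + 1) - (b : ℂ) • colCons 0 (blockCol s 0 j)

/-- `u_{2,j} = (-(a+b) s_0 + s_1, -ŝ_0, …, -ŝ_{j-1})`. -/
def u₂ (a b : ℝ) (s : ℕ → Mat q) (j : ℕ) : BlockCol (j + 1) q :=
  colCons (-((a + b : ℂ) • s 0) + s 1) (-blockCol (sHat a b s) 0 j)

/-- The block row `(-Y_{2,j}^* H_{2,j-1}⁻¹, I_q)` for `j ≥ 1`, and `I_q` for `j = 0`. -/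
def rowH₂ (a b : ℝ) (s : ℕ → Mat q) : (j : ℕ) → BlockRow (j + 1) q
  | 0 => rowSnoc 0 1
  | j + 1 => rowSnoc (-((Y₂ a b s (j + 1))ᴴ * (H₂ a b s j)⁻¹)) 1

/-- The block row `(-Ỹ_{1,j}^* K_{1,j-1}⁻¹, I_q)` for `j ≥ 1`, and `I_q` for `j = 0`. -/
def rowK₁ (b : ℝ) (s : ℕ → Mat q) : (j : ℕ) → BlockRow (j + 1) q
  | 0 => rowSnoc 0 1
  | j + 1 => rowSnoc (-((Y₁tilde b s (j + 1))ᴴ * (K₁ b s j)⁻¹)) 1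

/-- The polynomials `P_{2,j}`, with `P_{2,0} = I_q`. -/
def P₂ (a b : ℝ) (s : ℕ → Mat q) (j : ℕ) (z : ℂ) : Mat q :=
  rowH₂ a b s j * R q j z * v q j

/-- The second kind polynomials `Q_{2,j}`, with `Q_{2,0}(z) = (a + b) s_0 - s_1 - z s_0`. -/
def Q₂ (a b : ℝ) (s : ℕ → Mat q) (j : ℕ) (z : ℂ) : Mat q :=
  -(rowH₂ a b s j * R q j z * (u₂ a b s j + z • (v q j * s 0)))

/-- The polynomials `Γ_{1,j}`, with `Γ_{1,0} = I_q`. -/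
def Γ₁ (b : ℝ) (s : ℕ → Mat q) (j : ℕ) (z : ℂ) : Mat q :=
  rowK₁ b s j * R q j z * v q j

/-- The second kind polynomials `Θ_{1,j}`, with `Θ_{1,0} = s_0`. -/
def Θ₁ (b : ℝ) (s : ℕ → Mat q) (j : ℕ) (z : ℂ) : Mat q :=
  rowK₁ b s j * R q j z * u₁tilde b s j

/-- `v_j^* R_j^*(a) K_{1,j}⁻¹ R_j(a) v_j`. -/
def t (a b : ℝ) (s : ℕ → Mat q) (j : ℕ) : Mat q :=
  (v q j)ᴴ * (R q j a)ᴴ * (K₁ b s j)⁻¹ * R q j a * v q j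

/-- `(u_{2,j}^* + a s_0 v_j^*) R_j^*(a) H_{2,j}⁻¹ R_j(a) (u_{2,j} + a v_j s_0)`. -/
def w (a b : ℝ) (s : ℕ → Mat q) (j : ℕ) : Mat q :=
  ((u₂ a b s j)ᴴ + (a : ℂ) • (s 0 * (v q j)ᴴ)) * (R q j a)ᴴ * (H₂ a b s j)⁻¹ * R q j a *
    (u₂ a b s j + (a : ℂ) • (v q j * s 0))

/-- The Dyukarev–Stieltjes parameters `m_j`. -/
def mParam (a b : ℝ) (s : ℕ → Mat q) : ℕ → Mat q
  | 0 => t a b s 0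
  | j + 1 => t a b s (j + 1) - t a b s j

/-- The Dyukarev–Stieltjes parameters `l_j`, `j ≥ 0`. -/
def lParam (a b : ℝ) (s : ℕ → Mat q) : ℕ → Mat q
  | 0 => w a b s 0
  | j + 1 => w a b s (j + 1) - w a b s j

/-- The ordered product `m_0⁻¹ l_0⁻¹ m_1⁻¹ l_1⁻¹ ⋯ m_{j-1}⁻¹ l_{j-1}⁻¹` (the identity for
`j = 0`). -/
def invProd (a b : ℝ) (s : ℕ → Mat q) : ℕ → Mat q
  | 0 => 1
  | j + 1 => invProd a b s j * (mParam a b s j)⁻¹ * (lParam a b s j)⁻¹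

end HausdorffMoment

end

noncomputable section

/-!
The row `(-C A⁻¹, I)` of `M = [[A, B], [C, D]]` eliminates `C`. Every block row `ρ` whose last block
is `I` satisfies `ρ [A; C] A⁻¹ = (first blocks of ρ) + C A⁻¹`. Hence if in addition `ρ M = c Uᴴ`,
then passing from `A` to `M` increases `c Uᴴ M⁻¹ U` by `(-C A⁻¹, I) U`. Moreover `c` is invertible,
since the last block of `ρ = c Uᴴ M⁻¹` is `I`.

Let `Φ` and `Ψ` be the Hankel matrices of `(b - x) dσ` and `(x - a)(b - x) dσ`. The division of
polynomials by `x - a` with remainder turns the orthogonality relations of the rows for `Ψ_j` and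
`Φ_{j+1}` into relations `ρ Φ_j = Q_{2,j}(a) Uᴴ` and `ρ' Ψ_j = -Γ_{1,j+1}(a) U'ᴴ`, where
`t_j = Uᴴ Φ_j⁻¹ U` and `w_j = U'ᴴ Ψ_j⁻¹ U'`. So `Q_{2,j}(a) m_j = Γ_{1,j}(a)` and
`Γ_{1,j+1}(a) l_j = -Q_{2,j}(a)`, and iteration from `Γ_{1,0} = I` gives the products.
-/

namespace HausdorffMoment

/-! ### Elimination of the last block row -/

section BlockElimination

variable {𝕜 ι : Type*} [CommRing 𝕜] [DecidableEq ι]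

/-- The 0-1 matrix of a map `e` of index sets: its column with index `i` is the standard basis
vector with index `e i`. It is used to pick rows and columns by matrix multiplication. -/
def coordEmb (𝕜 : Type*) [CommRing 𝕜] {m n : Type*} [DecidableEq n] (e : m → n) : Matrix n m 𝕜 :=
  (1 : Matrix n n 𝕜).submatrix id e

/-- The embedding of block columns with `k` blocks as the first `k` of `k + 1` blocks. -/
def initEmb (𝕜 : Type*) [CommRing 𝕜] (ι : Type*) [DecidableEq ι] (k : ℕ) :
    Matrix (Fin (k + 1) × ι) (Fin k × ι) 𝕜 :=
  coordEmb 𝕜 fun y => (y.1.castSucc, y.2)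

/-- The embedding of block columns with `k` blocks as the last `k` of `k + 1` blocks. -/
def tailEmb (𝕜 : Type*) [CommRing 𝕜] (ι : Type*) [DecidableEq ι] (k : ℕ) :
    Matrix (Fin (k + 1) × ι) (Fin k × ι) 𝕜 :=
  coordEmb 𝕜 fun y => (y.1.succ, y.2)

/-- The block column `(0, …, 0, I)` with `k + 1` blocks. -/
def lastCol (𝕜 : Type*) [CommRing 𝕜] (ι : Type*) [DecidableEq ι] (k : ℕ) :
    Matrix (Fin (k + 1) × ι) ι 𝕜 :=
  coordEmb 𝕜 fun α => (Fin.last k, α)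

lemma mul_coordEmb {l m n : Type*} [Fintype n] [DecidableEq n] (X : Matrix l n 𝕜) (e : m → n) :
    X * coordEmb 𝕜 e = X.submatrix id e :=
  Matrix.mul_submatrix_one (Equiv.refl n) e X

lemma eq_of_mul_initEmb_of_mul_lastCol [Fintype ι] {n : Type*} {k : ℕ}
    {X Y : Matrix n (Fin (k + 1) × ι) 𝕜}
    (hinit : X * initEmb 𝕜 ι k = Y * initEmb 𝕜 ι k)
    (hlast : X * lastCol 𝕜 ι k = Y * lastCol 𝕜 ι k) : X = Y := by
  simp only [initEmb, lastCol, mul_coordEmb] at hinit hlast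
  ext x ⟨l, β⟩
  cases l using Fin.lastCases with
  | last => exact congr($hlast x β)
  | cast l => exact congr($hinit x (l, β))

variable [StarRing 𝕜]

section CoordEmb

variable {l m n : Type*} [Fintype n] [DecidableEq n]

lemma conjTranspose_coordEmb_mul (e : m → n) (X : Matrix n l 𝕜) :
    (coordEmb 𝕜 e)ᴴ * X = X.submatrix e id := by
  rw [← Matrix.conjTranspose_conjTranspose X, ← Matrix.conjTranspose_mul, mul_coordEmb,
    Matrix.conjTranspose_submatrix]

lemma conjTranspose_coordEmb_mul_self [DecidableEq m] {e : m → n} (he : e.Injective) :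
    (coordEmb 𝕜 e)ᴴ * coordEmb 𝕜 e = 1 := by
  rw [conjTranspose_coordEmb_mul, coordEmb, Matrix.submatrix_submatrix]
  exact Matrix.submatrix_one e he

lemma conjTranspose_coordEmb_mul_of_ne {e : m → n} {e' : l → n} (h : ∀ i j, e i ≠ e' j) :
    (coordEmb 𝕜 e)ᴴ * coordEmb 𝕜 e' = 0 := by
  rw [conjTranspose_coordEmb_mul]
  ext i j
  exact Matrix.one_apply_ne (h i j)

end CoordEmb

variable [Fintype ι]

lemma conjTranspose_initEmb_mul_initEmb (k : ℕ) : (initEmb 𝕜 ι k)ᴴ * initEmb 𝕜 ι k = 1 :=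
  conjTranspose_coordEmb_mul_self fun x y h => by simpa [Prod.ext_iff] using h

lemma conjTranspose_lastCol_mul_lastCol (k : ℕ) : (lastCol 𝕜 ι k)ᴴ * lastCol 𝕜 ι k = 1 :=
  conjTranspose_coordEmb_mul_self fun x y h => by simpa using h

lemma conjTranspose_initEmb_mul_lastCol (k : ℕ) : (initEmb 𝕜 ι k)ᴴ * lastCol 𝕜 ι k = 0 :=
  conjTranspose_coordEmb_mul_of_ne fun i _ h => i.1.castSucc_ne_last congr(($h).1)

lemma conjTranspose_lastCol_mul_initEmb (k : ℕ) : (lastCol 𝕜 ι k)ᴴ * initEmb 𝕜 ι k = 0 :=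
  conjTranspose_coordEmb_mul_of_ne fun _ j h => j.1.castSucc_ne_last congr(($h).1).symm

lemma initEmb_mul_conjTranspose_add_lastCol_mul_conjTranspose (k : ℕ) :
    initEmb 𝕜 ι k * (initEmb 𝕜 ι k)ᴴ + lastCol 𝕜 ι k * (lastCol 𝕜 ι k)ᴴ = 1 := by
  apply eq_of_mul_initEmb_of_mul_lastCol <;>
    simp only [Matrix.add_mul, Matrix.mul_assoc, conjTranspose_initEmb_mul_initEmb,
      conjTranspose_lastCol_mul_initEmb, conjTranspose_initEmb_mul_lastCol,
      conjTranspose_lastCol_mul_lastCol, Matrix.mul_one, Matrix.one_mul, Matrix.mul_zero, add_zero,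
      zero_add]

variable {k : ℕ}

/-- The leading principal `k × k` block submatrix. -/
def leadingBlock (M : Matrix (Fin (k + 1) × ι) (Fin (k + 1) × ι) 𝕜) :
    Matrix (Fin k × ι) (Fin k × ι) 𝕜 :=
  (initEmb 𝕜 ι k)ᴴ * M * initEmb 𝕜 ι k

/-- The block row `(-C A⁻¹, I)` of `M = [[A, B], [C, D]]`, where `D` is the last diagonal block.
For block Hankel matrices these are the coefficients of the monic left orthogonal polynomial. -/
def schurRow (M : Matrix (Fin (k + 1) × ι) (Fin (k + 1) × ι) 𝕜) : Matrix ι (Fin (k + 1) × ι) 𝕜 :=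
  (lastCol 𝕜 ι k)ᴴ -
    (lastCol 𝕜 ι k)ᴴ * M * initEmb 𝕜 ι k * (leadingBlock M)⁻¹ * (initEmb 𝕜 ι k)ᴴ

/-- The Hermitian form `Uᴴ M⁻¹ U`. -/
def invForm {m n : Type*} [Fintype m] [DecidableEq m] (M : Matrix m m 𝕜) (U : Matrix m n 𝕜) :
    Matrix n n 𝕜 :=
  Uᴴ * M⁻¹ * U

lemma invForm_of_isEmpty {m n : Type*} [Fintype m] [DecidableEq m] [IsEmpty m] (M : Matrix m m 𝕜)
    (U : Matrix m n 𝕜) : invForm M U = 0 := by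
  ext α β
  simp [invForm, Matrix.mul_apply]

variable {M : Matrix (Fin (k + 1) × ι) (Fin (k + 1) × ι) 𝕜}

lemma schurRow_mul_lastCol (M : Matrix (Fin (k + 1) × ι) (Fin (k + 1) × ι) 𝕜) :
    schurRow M * lastCol 𝕜 ι k = 1 := by
  rw [schurRow, Matrix.sub_mul, Matrix.mul_assoc _ (initEmb 𝕜 ι k)ᴴ,
    conjTranspose_initEmb_mul_lastCol, Matrix.mul_zero, sub_zero,
    conjTranspose_lastCol_mul_lastCol]

lemma mul_mul_leadingBlock_inv {ρ : Matrix ι (Fin (k + 1) × ι) 𝕜} (hρ : ρ * lastCol 𝕜 ι k = 1)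
    (hM : IsUnit (leadingBlock M)) :
    ρ * M * initEmb 𝕜 ι k * (leadingBlock M)⁻¹ * (initEmb 𝕜 ι k)ᴴ = ρ - schurRow M := by
  have hsplit : ρ = ρ * initEmb 𝕜 ι k * (initEmb 𝕜 ι k)ᴴ + (lastCol 𝕜 ι k)ᴴ := by
    rw [← Matrix.one_mul (lastCol 𝕜 ι k)ᴴ, ← hρ, Matrix.mul_assoc, Matrix.mul_assoc,
      ← Matrix.mul_add, initEmb_mul_conjTranspose_add_lastCol_mul_conjTranspose, Matrix.mul_one]
  have hmul : ρ * M * initEmb 𝕜 ι k =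
      ρ * initEmb 𝕜 ι k * leadingBlock M + (lastCol 𝕜 ι k)ᴴ * M * initEmb 𝕜 ι k := by
    conv_lhs => rw [hsplit]
    simp only [leadingBlock, Matrix.add_mul, Matrix.mul_assoc]
  rw [hmul, Matrix.add_mul, Matrix.add_mul, Matrix.mul_nonsing_inv_cancel_right _ _
    ((Matrix.isUnit_iff_isUnit_det _).1 hM), schurRow, sub_sub_eq_add_sub]
  exact eq_sub_of_add_eq (by rw [add_right_comm, ← hsplit])

lemma schurRow_mul_mul_initEmb (hM : IsUnit (leadingBlock M)) :
    schurRow M * M * initEmb 𝕜 ι k = 0 := by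
  simp only [schurRow, Matrix.sub_mul]
  rw [Matrix.mul_assoc _ (initEmb 𝕜 ι k)ᴴ, Matrix.mul_assoc _ ((initEmb 𝕜 ι k)ᴴ * M),
    ← leadingBlock, Matrix.nonsing_inv_mul_cancel_right _ _
      ((Matrix.isUnit_iff_isUnit_det _).1 hM), sub_self]

section MonicRow

variable {ρ : Matrix ι (Fin (k + 1) × ι) 𝕜} {c : Matrix ι ι 𝕜} {U : Matrix (Fin (k + 1) × ι) ι 𝕜}

lemma isUnit_of_mul_eq_mul_conjTranspose (hM : IsUnit M) (hρ : ρ * lastCol 𝕜 ι k = 1)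
    (h : ρ * M = c * Uᴴ) : IsUnit c := by
  apply IsUnit.of_mul_eq_one (Uᴴ * M⁻¹ * lastCol 𝕜 ι k)
  rw [← Matrix.mul_assoc, ← Matrix.mul_assoc, ← h, Matrix.mul_nonsing_inv_cancel_right _ _
    ((Matrix.isUnit_iff_isUnit_det _).1 hM), hρ]

lemma mul_invForm (hM : IsUnit M) (h : ρ * M = c * Uᴴ) : c * invForm M U = ρ * U := by
  rw [invForm, ← Matrix.mul_assoc, ← Matrix.mul_assoc, ← h, Matrix.mul_nonsing_inv_cancel_right _ _
    ((Matrix.isUnit_iff_isUnit_det _).1 hM)]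

lemma mul_invForm_sub_invForm_leadingBlock (hM : IsUnit M) (hM₀ : IsUnit (leadingBlock M))
    (hρ : ρ * lastCol 𝕜 ι k = 1) (h : ρ * M = c * Uᴴ) :
    c * (invForm M U - invForm (leadingBlock M) ((initEmb 𝕜 ι k)ᴴ * U)) = schurRow M * U := by
  have hlead : c * invForm (leadingBlock M) ((initEmb 𝕜 ι k)ᴴ * U) = (ρ - schurRow M) * U := by
    rw [← mul_mul_leadingBlock_inv hρ hM₀, h]
    simp only [invForm, Matrix.conjTranspose_mul, Matrix.conjTranspose_conjTranspose,
      Matrix.mul_assoc]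
  rw [Matrix.mul_sub, mul_invForm hM h, hlead, Matrix.sub_mul, sub_sub_cancel]

end MonicRow

end BlockElimination

variable {q : ℕ}

lemma v_eq_coordEmb (j : ℕ) : v q j = coordEmb ℂ fun α => ((0 : Fin (j + 1)), α) := by
  ext ⟨i, α⟩ β
  cases i using Fin.cases <;> simp [v, colCons, coordEmb, Matrix.one_apply]

lemma conjTranspose_v_mul_v (j : ℕ) : (v q j)ᴴ * v q j = 1 := by
  rw [v_eq_coordEmb]
  exact conjTranspose_coordEmb_mul_self fun x y h => by simpa using h

lemma conjTranspose_v_mul_tailEmb (j : ℕ) : (v q j)ᴴ * tailEmb ℂ (Fin q) j = 0 := by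
  rw [v_eq_coordEmb]
  exact conjTranspose_coordEmb_mul_of_ne fun _ i h => i.1.succ_ne_zero congr(($h).1).symm

lemma conjTranspose_tailEmb_mul_v (j : ℕ) : (tailEmb ℂ (Fin q) j)ᴴ * v q j = 0 := by
  rw [v_eq_coordEmb]
  exact conjTranspose_coordEmb_mul_of_ne fun i _ h => i.1.succ_ne_zero congr(($h).1)

lemma conjTranspose_tailEmb_mul_tailEmb (j : ℕ) :
    (tailEmb ℂ (Fin q) j)ᴴ * tailEmb ℂ (Fin q) j = 1 :=
  conjTranspose_coordEmb_mul_self fun x y h => by simpa [Prod.ext_iff] using h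

lemma eq_of_conjTranspose_v_mul_of_conjTranspose_tailEmb_mul {n : Type*} {j : ℕ}
    {X Y : Matrix (Fin (j + 1) × Fin q) n ℂ} (hhead : (v q j)ᴴ * X = (v q j)ᴴ * Y)
    (htail : (tailEmb ℂ (Fin q) j)ᴴ * X = (tailEmb ℂ (Fin q) j)ᴴ * Y) : X = Y := by
  simp only [v_eq_coordEmb, tailEmb, conjTranspose_coordEmb_mul] at hhead htail
  ext ⟨i, α⟩ y
  cases i using Fin.cases with
  | zero => exact congr($hhead α y)
  | succ i => exact congr($htail (i, α) y)

lemma T_eq (j : ℕ) : T q j = tailEmb ℂ (Fin q) j * (initEmb ℂ (Fin q) j)ᴴ := by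
  apply eq_of_conjTranspose_v_mul_of_conjTranspose_tailEmb_mul
  · rw [← Matrix.mul_assoc, conjTranspose_v_mul_tailEmb, Matrix.zero_mul, v_eq_coordEmb,
      conjTranspose_coordEmb_mul]
    ext α y
    simp [T]
  · rw [← Matrix.mul_assoc, conjTranspose_tailEmb_mul_tailEmb, Matrix.one_mul, tailEmb,
      conjTranspose_coordEmb_mul]
    ext x y
    simp [T, initEmb, coordEmb, Matrix.one_apply, Prod.ext_iff, Fin.ext_iff, eq_comm]

lemma isUnit_one_sub_smul_T (j : ℕ) (z : ℂ) : IsUnit (1 - z • T q j) := by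
  have htri : (1 - z • T q j).BlockTriangular (OrderDual.toDual ∘ Prod.fst) := fun x y hxy => by
    have hlt : (x.1 : ℕ) < y.1 := hxy
    have hne : x ≠ y := fun h => hlt.ne congr(($h).1)
    simp [T, Matrix.one_apply_ne hne, show (x.1 : ℕ) ≠ y.1 + 1 by omega]
  have hdiag (i : (Fin (j + 1))ᵒᵈ) :
      (1 - z • T q j).toSquareBlock (OrderDual.toDual ∘ Prod.fst) i = 1 := by
    ext ⟨x, hx⟩ ⟨y, hy⟩
    have hxy : (x.1 : ℕ) = y.1 := congr_arg Fin.val (OrderDual.toDual.injective (hx.trans hy.symm))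
    simp [Matrix.toSquareBlock, Matrix.toSquareBlockProp, T, Matrix.one_apply, hxy]
  rw [Matrix.isUnit_iff_isUnit_det, htri.det_fintype]
  simp only [hdiag, Matrix.det_one, Finset.prod_const_one, isUnit_one]

lemma R_mul_eq {n : Type*} {j : ℕ} {z : ℂ} {X Y : Matrix (Fin (j + 1) × Fin q) n ℂ}
    (hhead : (v q j)ᴴ * X = (v q j)ᴴ * Y)
    (htail : (tailEmb ℂ (Fin q) j)ᴴ * X =
      (tailEmb ℂ (Fin q) j)ᴴ * Y + z • ((initEmb ℂ (Fin q) j)ᴴ * X)) : R q j z * Y = X := by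
  have hY : (1 - z • T q j) * X = Y := by
    rw [Matrix.sub_mul, Matrix.one_mul, Matrix.smul_mul, T_eq, Matrix.mul_assoc]
    apply eq_of_conjTranspose_v_mul_of_conjTranspose_tailEmb_mul
    · rw [Matrix.mul_sub, Matrix.mul_smul, ← Matrix.mul_assoc, conjTranspose_v_mul_tailEmb,
        Matrix.zero_mul, smul_zero, sub_zero, hhead]
    · rw [Matrix.mul_sub, Matrix.mul_smul, ← Matrix.mul_assoc, conjTranspose_tailEmb_mul_tailEmb,
        Matrix.one_mul, htail, add_sub_cancel_right]
  rw [← hY, R, Matrix.nonsing_inv_mul_cancel_left _ _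
    ((Matrix.isUnit_iff_isUnit_det _).1 (isUnit_one_sub_smul_T j z))]

lemma tailEmb_mul_lastCol (j : ℕ) :
    tailEmb ℂ (Fin q) (j + 1) * lastCol ℂ (Fin q) j = lastCol ℂ (Fin q) (j + 1) := by
  rw [lastCol, mul_coordEmb]
  rfl

section BlockCol

variable (f : ℕ → Mat q) (i k : ℕ)

lemma conjTranspose_v_mul_blockCol : (v q k)ᴴ * blockCol f i (k + 1) = f i := by
  rw [v_eq_coordEmb, conjTranspose_coordEmb_mul]
  rfl

lemma conjTranspose_initEmb_mul_blockCol :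
    (initEmb ℂ (Fin q) k)ᴴ * blockCol f i (k + 1) = blockCol f i k := by
  rw [initEmb, conjTranspose_coordEmb_mul]
  rfl

lemma conjTranspose_tailEmb_mul_blockCol :
    (tailEmb ℂ (Fin q) k)ᴴ * blockCol f i (k + 1) = blockCol f (i + 1) k := by
  rw [tailEmb, conjTranspose_coordEmb_mul]
  ext x β
  simp [blockCol, add_assoc, add_comm 1]

end BlockCol

lemma colCons_eq {k : ℕ} (A : Mat q) (B : BlockCol k q) :
    colCons A B = v q k * A + tailEmb ℂ (Fin q) k * B := by
  apply eq_of_conjTranspose_v_mul_of_conjTranspose_tailEmb_mul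
  · rw [Matrix.mul_add, ← Matrix.mul_assoc, ← Matrix.mul_assoc, conjTranspose_v_mul_v,
      conjTranspose_v_mul_tailEmb, Matrix.one_mul, Matrix.zero_mul, add_zero, v_eq_coordEmb,
      conjTranspose_coordEmb_mul]
    rfl
  · rw [Matrix.mul_add, ← Matrix.mul_assoc, ← Matrix.mul_assoc, conjTranspose_tailEmb_mul_v,
      conjTranspose_tailEmb_mul_tailEmb, Matrix.one_mul, Matrix.zero_mul, zero_add, tailEmb,
      conjTranspose_coordEmb_mul]
    rfl

/-! ### Block Hankel matrices and division of polynomials -/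

/-- The block column `(I, z I, …, z^j I)`, which evaluates a polynomial with the coefficients
`A_0, …, A_j` at `z` as `(A_0, …, A_j)` times this column. -/
def powCol (q j : ℕ) (z : ℂ) : BlockCol (j + 1) q := blockCol (fun i => z ^ i • 1) 0 (j + 1)

/-- The matrix with the blocks `z^(i-l-1) I` for `l < i`. Multiplying the coefficient row of a
polynomial `p` by it gives the coefficients of the difference quotient `(p(x) - p(z)) / (x - z)`. -/
def divDiff (q j : ℕ) (z : ℂ) : Matrix (Fin (j + 1) × Fin q) (Fin j × Fin q) ℂ :=
  R q j z * tailEmb ℂ (Fin q) j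

lemma R_mul_v (j : ℕ) (z : ℂ) : R q j z * v q j = powCol q j z := by
  apply R_mul_eq
  · rw [powCol, conjTranspose_v_mul_blockCol, conjTranspose_v_mul_v, pow_zero, one_smul]
  · rw [conjTranspose_tailEmb_mul_v, zero_add, powCol, conjTranspose_tailEmb_mul_blockCol,
      conjTranspose_initEmb_mul_blockCol]
    ext x β
    simp [blockCol, add_comm 1, pow_succ', mul_assoc]

lemma divDiff_mul_lastCol (j : ℕ) (z : ℂ) :
    divDiff q (j + 1) z * lastCol ℂ (Fin q) j = lastCol ℂ (Fin q) (j + 1) := by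
  rw [divDiff, Matrix.mul_assoc, tailEmb_mul_lastCol]
  apply R_mul_eq rfl
  rw [conjTranspose_initEmb_mul_lastCol, smul_zero, add_zero]

section Hankel

variable {f : ℕ → Mat q} {j : ℕ}

lemma leadingBlock_blockHankel_succ (f : ℕ → Mat q) (j : ℕ) :
    leadingBlock (blockHankel f (j + 1)) = blockHankel f j := by
  rw [leadingBlock, initEmb, mul_coordEmb, conjTranspose_coordEmb_mul]
  rfl

lemma isUnit_leadingBlock_blockHankel {n : ℕ} (h : ∀ j < n, IsUnit (blockHankel f j))
    (hj : j ≤ n) : IsUnit (leadingBlock (blockHankel f j)) := by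
  cases j with
  | zero => exact isUnit_of_subsingleton _
  | succ j => exact leadingBlock_blockHankel_succ f j ▸ h j hj

lemma isHermitian_blockHankel (hf : ∀ i ≤ 2 * j, (f i).IsHermitian) :
    (blockHankel f j).IsHermitian := by
  ext x y
  simpa [blockHankel, add_comm] using (hf (y.1 + x.1) (by omega)).apply x.2 y.2

lemma isHermitian_of_blockHankel (h : (blockHankel f j).IsHermitian) {i : ℕ} (hi : i ≤ 2 * j) :
    (f i).IsHermitian := by
  ext α β
  have hi' : i - i / 2 + i / 2 = i := by omega
  simpa [blockHankel, hi', add_comm (i / 2)] using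
    h.apply (⟨i / 2, by omega⟩, α) (⟨i - i / 2, by omega⟩, β)

lemma posDef_blockHankel_of_le {m : ℕ} (h : (blockHankel f m).PosDef) (hj : j ≤ m) :
    (blockHankel f j).PosDef :=
  h.submatrix (e := Prod.map (Fin.castLE (Nat.succ_le_succ hj)) id)
    ((Fin.castLE_injective _).prodMap Function.injective_id)

lemma rowSnoc_one_eq {k : ℕ} (A : BlockRow k q) :
    rowSnoc A 1 = (lastCol ℂ (Fin q) k)ᴴ + A * (initEmb ℂ (Fin q) k)ᴴ := by
  apply eq_of_mul_initEmb_of_mul_lastCol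
  · rw [Matrix.add_mul, conjTranspose_lastCol_mul_initEmb, Matrix.mul_assoc,
      conjTranspose_initEmb_mul_initEmb, zero_add, Matrix.mul_one, initEmb, mul_coordEmb]
    ext α y
    simp [rowSnoc]
  · rw [Matrix.add_mul, conjTranspose_lastCol_mul_lastCol, Matrix.mul_assoc,
      conjTranspose_initEmb_mul_lastCol, Matrix.mul_zero, add_zero, lastCol, mul_coordEmb]
    ext α y
    simp [rowSnoc]

lemma schurRow_blockHankel (hf : ∀ i < 2 * j, (f i).IsHermitian) :
    schurRow (blockHankel f j) =
      rowSnoc (-((blockCol f j j)ᴴ * (leadingBlock (blockHankel f j))⁻¹)) 1 := by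
  have hlast : (lastCol ℂ (Fin q) j)ᴴ * blockHankel f j * initEmb ℂ (Fin q) j =
      (blockCol f j j)ᴴ := by
    rw [initEmb, lastCol, mul_coordEmb, conjTranspose_coordEmb_mul]
    ext α y
    simpa [blockHankel, blockCol] using ((hf (j + y.1) (by omega)).apply α y.2).symm
  rw [schurRow, rowSnoc_one_eq, hlast, Matrix.neg_mul, sub_eq_add_neg]

/-- The moments of `(x - z) dσ`, where `f` are the moments of `dσ`. -/
def mulXSub (z : ℂ) (f : ℕ → Mat q) (k : ℕ) : Mat q := f (k + 1) - z • f k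

lemma isHermitian_mulXSub {z : ℝ} {k : ℕ} (h₀ : (f k).IsHermitian)
    (h₁ : (f (k + 1)).IsHermitian) : (mulXSub z f k).IsHermitian :=
  h₁.sub (h₀.smul (Complex.conj_ofReal z))

lemma blockHankel_mulXSub_eq_mul (z : ℝ) (f : ℕ → Mat q) (j : ℕ) :
    blockHankel (mulXSub z (mulXSub z f)) j =
      (tailEmb ℂ (Fin q) (j + 1) - (z : ℂ) • initEmb ℂ (Fin q) (j + 1))ᴴ *
        blockHankel f (j + 1) *
        (tailEmb ℂ (Fin q) (j + 1) - (z : ℂ) • initEmb ℂ (Fin q) (j + 1)) := by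
  simp only [Matrix.conjTranspose_sub, Matrix.conjTranspose_smul, Matrix.sub_mul, Matrix.mul_sub,
    Matrix.smul_mul, Matrix.mul_smul, initEmb, tailEmb, mul_coordEmb, conjTranspose_coordEmb_mul]
  ext x y
  simp [blockHankel, mulXSub, add_right_comm _ 1, ← add_assoc]

/-- Division of polynomials by `x - z` with remainder, in terms of moments. -/
lemma blockHankel_eq_powCol_mul_add (hf : ∀ i ≤ j, (f i).IsHermitian) (z : ℂ) :
    blockHankel f j = powCol q j z * (blockCol f 0 (j + 1))ᴴ +
      divDiff q j z * ((initEmb ℂ (Fin q) j)ᴴ * blockHankel (mulXSub z f) j) := by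
  rw [← R_mul_v, divDiff, Matrix.mul_assoc, Matrix.mul_assoc, ← Matrix.mul_add, eq_comm]
  apply R_mul_eq
  · rw [Matrix.mul_add, ← Matrix.mul_assoc, ← Matrix.mul_assoc, conjTranspose_v_mul_v,
      conjTranspose_v_mul_tailEmb, Matrix.one_mul, Matrix.zero_mul, add_zero, v_eq_coordEmb,
      conjTranspose_coordEmb_mul]
    ext α y
    simpa [blockHankel, blockCol] using ((hf y.1 (by omega)).apply α y.2).symm
  · rw [Matrix.mul_add, ← Matrix.mul_assoc, ← Matrix.mul_assoc, conjTranspose_tailEmb_mul_v,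
      conjTranspose_tailEmb_mul_tailEmb, Matrix.one_mul, Matrix.zero_mul, zero_add, tailEmb,
      initEmb, conjTranspose_coordEmb_mul, conjTranspose_coordEmb_mul, conjTranspose_coordEmb_mul]
    ext x y
    simp [blockHankel, mulXSub, add_right_comm]

lemma mul_blockHankel_eq_mul_conjTranspose_powCol {ρ : BlockRow (j + 1) q} {z : ℝ}
    (hf : ∀ i ≤ 2 * j + 1, (f i).IsHermitian)
    (hρ : ρ * blockHankel (mulXSub z f) j * initEmb ℂ (Fin q) j = 0) :
    ρ * blockHankel f j = ρ * blockCol f 0 (j + 1) * (powCol q j z)ᴴ := by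
  have hf₀ : (blockHankel f j).IsHermitian := isHermitian_blockHankel fun i hi => hf i (by omega)
  have hf₁ : (blockHankel (mulXSub z f) j).IsHermitian := isHermitian_blockHankel fun i hi =>
    isHermitian_mulXSub (hf i (by omega)) (hf (i + 1) (by omega))
  have hdiv := congr_arg Matrix.conjTranspose
    (blockHankel_eq_powCol_mul_add (j := j) (fun i hi => hf i (by omega)) (z : ℂ))
  simp only [Matrix.conjTranspose_add, Matrix.conjTranspose_mul,
    Matrix.conjTranspose_conjTranspose, hf₀.eq, hf₁.eq] at hdiv
  rw [hdiv, Matrix.mul_add, ← Matrix.mul_assoc, ← Matrix.mul_assoc, ← Matrix.mul_assoc, hρ,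
    Matrix.zero_mul, add_zero]

lemma mul_divDiff_mul_blockHankel {ρ : BlockRow (j + 2) q} (hf : ∀ i ≤ j + 1, (f i).IsHermitian)
    (z : ℂ) (hρ : ρ * blockHankel f (j + 1) * initEmb ℂ (Fin q) (j + 1) = 0) :
    ρ * divDiff q (j + 1) z * blockHankel (mulXSub z f) j =
      -(ρ * powCol q (j + 1) z) * (blockCol f 0 (j + 1))ᴴ := by
  have hcol : (blockCol f 0 (j + 2))ᴴ * initEmb ℂ (Fin q) (j + 1) = (blockCol f 0 (j + 1))ᴴ := by
    rw [← conjTranspose_initEmb_mul_blockCol f 0 (j + 1), Matrix.conjTranspose_mul,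
      Matrix.conjTranspose_conjTranspose]
  rw [blockHankel_eq_powCol_mul_add hf z, Matrix.mul_assoc, Matrix.add_mul, Matrix.mul_assoc, hcol,
    Matrix.mul_assoc (divDiff q _ z), ← leadingBlock, leadingBlock_blockHankel_succ,
    Matrix.mul_add, ← Matrix.mul_assoc, ← Matrix.mul_assoc] at hρ
  rw [Matrix.neg_mul]
  exact eq_neg_of_add_eq_zero_right hρ

end Hankel

/-! ### Nondegenerate moment sequences -/

/-- The moments of `(b - x) dσ`, where `s` are the moments of `dσ`. -/
def upperMoment (b : ℝ) (s : ℕ → Mat q) (k : ℕ) : Mat q := (b : ℂ) • s k - s (k + 1)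

section Moments

variable {a b : ℝ} {s : ℕ → Mat q} {j : ℕ}

lemma sHat_eq (a b : ℝ) (s : ℕ → Mat q) : sHat a b s = mulXSub a (upperMoment b s) := by
  ext1 k
  simp only [sHat, mulXSub, upperMoment]
  module

lemma K₁_eq (b : ℝ) (s : ℕ → Mat q) (j : ℕ) : K₁ b s j = blockHankel (upperMoment b s) j := rfl

lemma K₂_eq (a : ℝ) (s : ℕ → Mat q) (j : ℕ) : K₂ a s j = blockHankel (mulXSub a s) j := by
  rw [K₂, neg_add_eq_sub]
  rfl

lemma H₂_eq (a b : ℝ) (s : ℕ → Mat q) (j : ℕ) : H₂ a b s j = blockHankel (sHat a b s) j := rfl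

lemma isHermitian_upperMoment {k : ℕ} (h₀ : (s k).IsHermitian) (h₁ : (s (k + 1)).IsHermitian) :
    (upperMoment b s k).IsHermitian :=
  (h₀.smul (Complex.conj_ofReal b)).sub h₁

lemma rowH₂_eq_schurRow (hs : ∀ i < 2 * j, (sHat a b s i).IsHermitian) :
    rowH₂ a b s j = schurRow (H₂ a b s j) := by
  rw [H₂_eq, schurRow_blockHankel hs]
  cases j with
  | zero => exact congr_arg (rowSnoc · 1) (Subsingleton.elim _ _)
  | succ j => rw [leadingBlock_blockHankel_succ, rowH₂, Y₂, H₂_eq]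

lemma rowK₁_eq_schurRow (hs : ∀ i < 2 * j, (upperMoment b s i).IsHermitian) :
    rowK₁ b s j = schurRow (K₁ b s j) := by
  rw [K₁_eq, schurRow_blockHankel hs]
  cases j with
  | zero => exact congr_arg (rowSnoc · 1) (Subsingleton.elim _ _)
  | succ j =>
    have hY : Y₁tilde b s (j + 1) = blockCol (upperMoment b s) (j + 1) (j + 1) := by
      ext x β
      simp [Y₁tilde, blockCol, upperMoment, add_right_comm]
    rw [leadingBlock_blockHankel_succ, rowK₁, hY, K₁_eq]

lemma R_mul_u₂_add (a b : ℝ) (s : ℕ → Mat q) (j : ℕ) :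
    R q j a * (u₂ a b s j + (a : ℂ) • (v q j * s 0)) = -blockCol (upperMoment b s) 0 (j + 1) := by
  rw [u₂, colCons_eq]
  apply R_mul_eq
  · simp only [Matrix.mul_add, Matrix.mul_neg, Matrix.mul_smul, ← Matrix.mul_assoc,
      conjTranspose_v_mul_v, conjTranspose_v_mul_tailEmb, conjTranspose_v_mul_blockCol,
      Matrix.one_mul, Matrix.zero_mul, upperMoment]
    module
  · simp only [Matrix.mul_add, Matrix.mul_neg, Matrix.mul_smul, ← Matrix.mul_assoc,
      conjTranspose_tailEmb_mul_v, conjTranspose_tailEmb_mul_tailEmb,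
      conjTranspose_tailEmb_mul_blockCol, conjTranspose_initEmb_mul_blockCol, Matrix.one_mul,
      Matrix.zero_mul, sHat_eq]
    ext x β
    simp [blockCol, mulXSub, add_comm 1, sub_add_eq_add_sub]

lemma R_mul_u₁tilde (z : ℂ) (b : ℝ) (s : ℕ → Mat q) (j : ℕ) :
    R q j z * u₁tilde b s j =
      powCol q j z * s 0 - divDiff q j z * blockCol (upperMoment b s) 0 j := by
  have hu : u₁tilde b s j =
      v q j * s 0 - tailEmb ℂ (Fin q) j * blockCol (upperMoment b s) 0 j := by
    rw [u₁tilde, colCons_eq, Matrix.mul_zero, zero_add]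
    apply eq_of_conjTranspose_v_mul_of_conjTranspose_tailEmb_mul
    · simp only [Matrix.mul_sub, Matrix.mul_smul, ← Matrix.mul_assoc, conjTranspose_v_mul_v,
        conjTranspose_v_mul_tailEmb, conjTranspose_v_mul_blockCol, Matrix.one_mul,
        Matrix.zero_mul, smul_zero]
    · simp only [Matrix.mul_sub, Matrix.mul_smul, ← Matrix.mul_assoc,
        conjTranspose_tailEmb_mul_v, conjTranspose_tailEmb_mul_tailEmb,
        conjTranspose_tailEmb_mul_blockCol, Matrix.one_mul, Matrix.zero_mul]
      ext x β
      simp [blockCol, upperMoment, add_comm 1]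
  rw [hu, Matrix.mul_sub, ← Matrix.mul_assoc, ← Matrix.mul_assoc, R_mul_v, divDiff]

lemma Γ₁_zero (b : ℝ) (s : ℕ → Mat q) (z : ℂ) : Γ₁ b s 0 z = 1 := by
  rw [Γ₁, Matrix.mul_assoc, R_mul_v, rowK₁, rowSnoc_one_eq, Matrix.zero_mul, add_zero, lastCol,
    conjTranspose_coordEmb_mul]
  ext α β
  simp [powCol, blockCol]

lemma Θ₁_eq (b : ℝ) (s : ℕ → Mat q) (j : ℕ) (z : ℂ) :
    Θ₁ b s j z = Γ₁ b s j z * s 0 -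
      rowK₁ b s j * divDiff q j z * blockCol (upperMoment b s) 0 j := by
  rw [Θ₁, Γ₁, Matrix.mul_assoc, R_mul_u₁tilde, Matrix.mul_sub, ← R_mul_v]
  simp only [Matrix.mul_assoc]

lemma t_eq (a b : ℝ) (s : ℕ → Mat q) (j : ℕ) :
    t a b s j = invForm (K₁ b s j) (powCol q j a) := by
  simp only [t, invForm, ← R_mul_v, Matrix.conjTranspose_mul, Matrix.mul_assoc]

lemma w_eq (hs : (s 0).IsHermitian) :
    w a b s j = invForm (H₂ a b s j) (blockCol (upperMoment b s) 0 (j + 1)) := by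
  have hu : (u₂ a b s j)ᴴ + (a : ℂ) • (s 0 * (v q j)ᴴ) =
      (u₂ a b s j + (a : ℂ) • (v q j * s 0))ᴴ := by
    rw [Matrix.conjTranspose_add, Matrix.conjTranspose_smul, Matrix.conjTranspose_mul, hs.eq,
      Complex.star_def, Complex.conj_ofReal]
  rw [w, hu, ← Matrix.conjTranspose_mul, Matrix.mul_assoc, R_mul_u₂_add, invForm,
    Matrix.conjTranspose_neg, Matrix.neg_mul, Matrix.neg_mul, Matrix.mul_neg, neg_neg]

lemma mParam_eq (a b : ℝ) (s : ℕ → Mat q) (j : ℕ) :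
    mParam a b s j = invForm (K₁ b s j) (powCol q j a) -
      invForm (leadingBlock (K₁ b s j)) ((initEmb ℂ (Fin q) j)ᴴ * powCol q j a) := by
  cases j with
  | zero => rw [mParam, t_eq, invForm_of_isEmpty (leadingBlock _), sub_zero]
  | succ j =>
    rw [mParam, t_eq, t_eq, K₁_eq, K₁_eq, leadingBlock_blockHankel_succ, powCol, powCol,
      conjTranspose_initEmb_mul_blockCol]

lemma lParam_eq (hs : (s 0).IsHermitian) :
    lParam a b s j = invForm (H₂ a b s j) (blockCol (upperMoment b s) 0 (j + 1)) -
      invForm (leadingBlock (H₂ a b s j))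
        ((initEmb ℂ (Fin q) j)ᴴ * blockCol (upperMoment b s) 0 (j + 1)) := by
  cases j with
  | zero => rw [lParam, w_eq hs, invForm_of_isEmpty (leadingBlock _), sub_zero]
  | succ j =>
    rw [lParam, w_eq hs, w_eq hs, H₂_eq, H₂_eq, leadingBlock_blockHankel_succ,
      conjTranspose_initEmb_mul_blockCol]

lemma sum_mParam (a b : ℝ) (s : ℕ → Mat q) (j : ℕ) :
    ∑ k ∈ Finset.range (j + 1), mParam a b s k = t a b s j := by
  induction j with
  | zero => simp [mParam]
  | succ j ih => rw [Finset.sum_range_succ, ih, mParam, add_sub_cancel]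

lemma sum_lParam (a b : ℝ) (s : ℕ → Mat q) (j : ℕ) :
    ∑ k ∈ Finset.range (j + 1), lParam a b s k = w a b s j := by
  induction j with
  | zero => simp [lParam]
  | succ j ih => rw [Finset.sum_range_succ, ih, lParam, add_sub_cancel]

end Moments

/-- Nondegenerate truncated moment sequences, possibly indefinite: `s_0, …, s_{2n}` are Hermitian,
and `K_{1,j}` and `H_{2,j}` are invertible for `j < n`. -/
structure IsRegular (a b : ℝ) (s : ℕ → Mat q) (n : ℕ) : Prop where
  isHermitian : ∀ k ≤ 2 * n, (s k).IsHermitian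
  isUnit_K₁ : ∀ j < n, IsUnit (K₁ b s j)
  isUnit_H₂ : ∀ j < n, IsUnit (H₂ a b s j)

namespace IsRegular

variable {a b : ℝ} {s : ℕ → Mat q} {n j : ℕ}

lemma isHermitian_upperMoment (h : IsRegular a b s n) {i : ℕ} (hi : i < 2 * n) :
    (upperMoment b s i).IsHermitian :=
  HausdorffMoment.isHermitian_upperMoment (h.isHermitian _ hi.le) (h.isHermitian _ hi)

lemma isHermitian_sHat (h : IsRegular a b s n) {i : ℕ} (hi : i + 1 < 2 * n) :
    (sHat a b s i).IsHermitian := by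
  rw [sHat_eq]
  exact isHermitian_mulXSub (h.isHermitian_upperMoment (by omega)) (h.isHermitian_upperMoment hi)

lemma rowH₂_eq (h : IsRegular a b s n) (hj : j < n) : rowH₂ a b s j = schurRow (H₂ a b s j) :=
  rowH₂_eq_schurRow fun _ hi => h.isHermitian_sHat (by omega)

lemma rowK₁_eq (h : IsRegular a b s n) (hj : j ≤ n) : rowK₁ b s j = schurRow (K₁ b s j) :=
  rowK₁_eq_schurRow fun _ hi => h.isHermitian_upperMoment (by omega)

lemma isUnit_leadingBlock_K₁ (h : IsRegular a b s n) (hj : j ≤ n) :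
    IsUnit (leadingBlock (K₁ b s j)) :=
  isUnit_leadingBlock_blockHankel (f := upperMoment b s) h.isUnit_K₁ hj

lemma isUnit_leadingBlock_H₂ (h : IsRegular a b s n) (hj : j ≤ n) :
    IsUnit (leadingBlock (H₂ a b s j)) :=
  isUnit_leadingBlock_blockHankel (f := sHat a b s) h.isUnit_H₂ hj

lemma rowH₂_mul_lastCol (h : IsRegular a b s n) (hj : j < n) :
    rowH₂ a b s j * lastCol ℂ (Fin q) j = 1 := by
  rw [h.rowH₂_eq hj, schurRow_mul_lastCol]

lemma rowH₂_mul_K₁ (h : IsRegular a b s n) (hj : j < n) :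
    rowH₂ a b s j * K₁ b s j = Q₂ a b s j a * (powCol q j a)ᴴ := by
  rw [Q₂, Matrix.mul_assoc, R_mul_u₂_add, Matrix.mul_neg, neg_neg, K₁_eq]
  apply mul_blockHankel_eq_mul_conjTranspose_powCol
  · exact fun i hi => h.isHermitian_upperMoment (by omega)
  · rw [← sHat_eq, ← H₂_eq, h.rowH₂_eq hj,
      schurRow_mul_mul_initEmb (h.isUnit_leadingBlock_H₂ hj.le)]

lemma rowK₁_mul_divDiff_mul_lastCol (h : IsRegular a b s n) (hj : j < n) :
    rowK₁ b s (j + 1) * divDiff q (j + 1) a * lastCol ℂ (Fin q) j = 1 := by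
  rw [Matrix.mul_assoc, divDiff_mul_lastCol, h.rowK₁_eq hj, schurRow_mul_lastCol]

lemma rowK₁_mul_divDiff_mul_H₂ (h : IsRegular a b s n) (hj : j < n) :
    rowK₁ b s (j + 1) * divDiff q (j + 1) a * H₂ a b s j =
      -Γ₁ b s (j + 1) a * (blockCol (upperMoment b s) 0 (j + 1))ᴴ := by
  rw [Γ₁, Matrix.mul_assoc (rowK₁ b s (j + 1)) (R q (j + 1) a), R_mul_v, H₂_eq, sHat_eq]
  apply mul_divDiff_mul_blockHankel fun i hi => h.isHermitian_upperMoment (by omega)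
  rw [← K₁_eq, h.rowK₁_eq hj, schurRow_mul_mul_initEmb (h.isUnit_leadingBlock_K₁ hj)]

lemma isUnit_Q₂ (h : IsRegular a b s n) (hj : j < n) : IsUnit (Q₂ a b s j a) :=
  isUnit_of_mul_eq_mul_conjTranspose (h.isUnit_K₁ j hj) (h.rowH₂_mul_lastCol hj)
    (h.rowH₂_mul_K₁ hj)

lemma isUnit_Γ₁_succ (h : IsRegular a b s n) (hj : j < n) : IsUnit (Γ₁ b s (j + 1) a) :=
  IsUnit.neg_iff _ |>.1 <| isUnit_of_mul_eq_mul_conjTranspose (h.isUnit_H₂ j hj)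
    (h.rowK₁_mul_divDiff_mul_lastCol hj) (h.rowK₁_mul_divDiff_mul_H₂ hj)

lemma P₂_eq_Q₂_mul_sum (h : IsRegular a b s n) (hj : j < n) :
    P₂ a b s j a = Q₂ a b s j a * ∑ k ∈ Finset.range (j + 1), mParam a b s k := by
  rw [sum_mParam, t_eq, mul_invForm (h.isUnit_K₁ j hj) (h.rowH₂_mul_K₁ hj), P₂, Matrix.mul_assoc,
    R_mul_v]

lemma Θ₁_eq_Γ₁_mul_add_sum (h : IsRegular a b s n) (hj : j ≤ n) :
    Θ₁ b s j a = Γ₁ b s j a * (s 0 + ∑ k ∈ Finset.range j, lParam a b s k) := by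
  rw [Θ₁_eq, Matrix.mul_add, sub_eq_add_neg]
  cases j with
  | zero =>
    rw [Subsingleton.elim (blockCol (upperMoment b s) 0 0) 0, Matrix.mul_zero, neg_zero,
      Finset.range_zero, Finset.sum_empty, Matrix.mul_zero]
  | succ j =>
    rw [sum_lParam, w_eq (h.isHermitian 0 (Nat.zero_le _)),
      ← mul_invForm (h.isUnit_H₂ j hj) (h.rowK₁_mul_divDiff_mul_H₂ hj), Matrix.neg_mul, neg_neg]

lemma Q₂_mul_mParam (h : IsRegular a b s n) (hj : j < n) :
    Q₂ a b s j a * mParam a b s j = Γ₁ b s j a := by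
  rw [mParam_eq, mul_invForm_sub_invForm_leadingBlock (h.isUnit_K₁ j hj)
    (h.isUnit_leadingBlock_K₁ hj.le) (h.rowH₂_mul_lastCol hj) (h.rowH₂_mul_K₁ hj),
    ← h.rowK₁_eq hj.le, Γ₁, Matrix.mul_assoc, R_mul_v]

lemma Γ₁_succ_mul_lParam (h : IsRegular a b s n) (hj : j < n) :
    Γ₁ b s (j + 1) a * lParam a b s j = -Q₂ a b s j a := by
  rw [← neg_inj, ← Matrix.neg_mul, lParam_eq (h.isHermitian 0 (Nat.zero_le _)),
    mul_invForm_sub_invForm_leadingBlock (h.isUnit_H₂ j hj) (h.isUnit_leadingBlock_H₂ hj.le)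
      (h.rowK₁_mul_divDiff_mul_lastCol hj) (h.rowK₁_mul_divDiff_mul_H₂ hj),
    ← h.rowH₂_eq hj, Q₂, neg_neg, Matrix.mul_assoc, R_mul_u₂_add, Matrix.mul_neg, neg_neg]

lemma isUnit_Γ₁ (h : IsRegular a b s n) (hj : j ≤ n) : IsUnit (Γ₁ b s j a) := by
  cases j with
  | zero => rw [Γ₁_zero]; exact isUnit_one
  | succ j => exact h.isUnit_Γ₁_succ hj

lemma isUnit_mParam (h : IsRegular a b s n) (hj : j < n) : IsUnit (mParam a b s j) :=
  (h.isUnit_Q₂ hj).mul_left_iff.1 <| (h.Q₂_mul_mParam hj).symm ▸ h.isUnit_Γ₁ hj.le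

lemma isUnit_lParam (h : IsRegular a b s n) (hj : j < n) : IsUnit (lParam a b s j) :=
  (h.isUnit_Γ₁ hj).mul_left_iff.1 <| (h.Γ₁_succ_mul_lParam hj).symm ▸ (h.isUnit_Q₂ hj).neg

lemma Q₂_eq_Γ₁_mul_inv (h : IsRegular a b s n) (hj : j < n) :
    Q₂ a b s j a = Γ₁ b s j a * (mParam a b s j)⁻¹ := by
  rw [← h.Q₂_mul_mParam hj, Matrix.mul_nonsing_inv_cancel_right _ _
    ((Matrix.isUnit_iff_isUnit_det _).1 (h.isUnit_mParam hj))]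

lemma Γ₁_succ_eq_neg_Q₂_mul_inv (h : IsRegular a b s n) (hj : j < n) :
    Γ₁ b s (j + 1) a = -Q₂ a b s j a * (lParam a b s j)⁻¹ := by
  rw [← h.Γ₁_succ_mul_lParam hj, Matrix.mul_nonsing_inv_cancel_right _ _
    ((Matrix.isUnit_iff_isUnit_det _).1 (h.isUnit_lParam hj))]

lemma Γ₁_eq_invProd (h : IsRegular a b s n) (hj : j ≤ n) :
    Γ₁ b s j a = (-1) ^ j * invProd a b s j := by
  induction j with
  | zero => rw [Γ₁_zero, pow_zero, one_mul, invProd]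
  | succ j ih =>
    rw [h.Γ₁_succ_eq_neg_Q₂_mul_inv hj, h.Q₂_eq_Γ₁_mul_inv hj, ih (Nat.le_of_succ_le hj), invProd,
      pow_succ, mul_neg_one]
    simp only [neg_mul, mul_assoc]

end IsRegular

/-! ### Hausdorff positive definite sequences -/

lemma posDef_conjTranspose_mul_mul_add {𝕜 m n p : Type*} [Ring 𝕜] [PartialOrder 𝕜] [StarRing 𝕜]
    [IsOrderedAddMonoid 𝕜] [Fintype m] [Fintype n] [Fintype p] {M : Matrix m m 𝕜}
    {N : Matrix n n 𝕜} (hM : M.PosDef) (hN : N.PosDef) {A : Matrix m p 𝕜} {B : Matrix n p 𝕜}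
    (hAB : ∀ x, A *ᵥ x = 0 → B *ᵥ x = 0 → x = 0) : (Aᴴ * M * A + Bᴴ * N * B).PosDef := by
  have hA := hM.posSemidef.conjTranspose_mul_mul_same A
  have hB := hN.posSemidef.conjTranspose_mul_mul_same B
  refine .of_dotProduct_mulVec_pos (hA.add hB).isHermitian fun x hx => ?_
  rw [Matrix.add_mulVec, dotProduct_add]
  by_cases hAx : A *ᵥ x = 0
  · refine add_pos_of_nonneg_of_pos (hA.dotProduct_mulVec_nonneg x) ?_
    simpa only [Matrix.star_mulVec, Matrix.dotProduct_mulVec, Matrix.vecMul_vecMul]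
      using hN.dotProduct_mulVec_pos fun hBx => hx (hAB x hAx hBx)
  · refine add_pos_of_pos_of_nonneg ?_ (hB.dotProduct_mulVec_nonneg x)
    simpa only [Matrix.star_mulVec, Matrix.dotProduct_mulVec, Matrix.vecMul_vecMul]
      using hM.dotProduct_mulVec_pos hAx

lemma posDef_of_ofReal_smul {m : Type*} {M : Matrix m m ℂ} {c : ℝ} (hc : 0 < c)
    (hM : ((c : ℂ) • M).PosDef) : M.PosDef := by
  have hc' : (c : ℂ) ≠ 0 := Complex.ofReal_ne_zero.2 hc.ne'
  rw [← inv_smul_smul₀ hc' M]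
  exact hM.smul (inv_pos.2 (Complex.zero_lt_real.2 hc))

section PosDef

variable {a b : ℝ} {s : ℕ → Mat q} {n : ℕ}

lemma posDef_K₁_of_posDef_H₁_of_posDef_H₂ (hab : a < b) (hH₁ : (H₁ s (n + 1)).PosDef)
    (hH₂ : (H₂ a b s n).PosDef) : (K₁ b s n).PosDef := by
  apply posDef_of_ofReal_smul (sub_pos.2 hab)
  have hmoment (k : ℕ) : ((b - a : ℝ) : ℂ) • upperMoment b s k =
      sHat a b s k + mulXSub b (mulXSub b s) k := by
    simp only [upperMoment, sHat, mulXSub, Complex.ofReal_sub]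
    module
  have hsum : ((b - a : ℝ) : ℂ) • K₁ b s n =
      H₂ a b s n + blockHankel (mulXSub b (mulXSub b s)) n := by
    ext x y
    exact congr($(hmoment (x.1 + y.1)) x.2 y.2)
  rw [hsum, blockHankel_mulXSub_eq_mul]
  exact hH₂.add_posSemidef (hH₁.posSemidef.conjTranspose_mul_mul_same _)

lemma posDef_H₁_of_posDef_K₁_of_posDef_K₂ (hab : a < b) (hK₁ : (K₁ b s n).PosDef)
    (hK₂ : (K₂ a s n).PosDef) : (H₁ s n).PosDef := by
  apply posDef_of_ofReal_smul (sub_pos.2 hab)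
  have hsum : ((b - a : ℝ) : ℂ) • H₁ s n = K₁ b s n + K₂ a s n := by
    rw [H₁, K₁, K₂, Complex.ofReal_sub]
    module
  rw [hsum]
  exact hK₁.add hK₂

lemma posDef_H₂_of_posDef_K₁_of_posDef_K₂ (hab : a < b) (hK₁ : (K₁ b s (n + 1)).PosDef)
    (hK₂ : (K₂ a s (n + 1)).PosDef) : (H₂ a b s n).PosDef := by
  apply posDef_of_ofReal_smul (sub_pos.2 hab)
  have hmoment (k : ℕ) : ((b - a : ℝ) : ℂ) • sHat a b s k =
      mulXSub a (mulXSub a (upperMoment b s)) k + mulXSub b (mulXSub b (mulXSub a s)) k := by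
    simp only [upperMoment, sHat, mulXSub, Complex.ofReal_sub]
    module
  have hsum : ((b - a : ℝ) : ℂ) • H₂ a b s n =
      blockHankel (mulXSub a (mulXSub a (upperMoment b s))) n +
        blockHankel (mulXSub b (mulXSub b (mulXSub a s))) n := by
    ext x y
    exact congr($(hmoment (x.1 + y.1)) x.2 y.2)
  rw [hsum, blockHankel_mulXSub_eq_mul, blockHankel_mulXSub_eq_mul]
  refine posDef_conjTranspose_mul_mul_add (K₁_eq b s _ ▸ hK₁) (K₂_eq a s _ ▸ hK₂)
    fun x ha hb => ?_
  have hx : ((b - a : ℝ) : ℂ) • initEmb ℂ (Fin q) (n + 1) *ᵥ x = 0 := by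
    rw [Matrix.sub_mulVec, Matrix.smul_mulVec] at ha hb
    rw [Complex.ofReal_sub, sub_smul, ← sub_eq_zero.1 ha, ← sub_eq_zero.1 hb, sub_self]
  have hx' := (smul_eq_zero.1 hx).resolve_left (Complex.ofReal_ne_zero.2 (sub_pos.2 hab).ne')
  rw [← Matrix.one_mulVec x, ← conjTranspose_initEmb_mul_initEmb, ← Matrix.mulVec_mulVec, hx',
    Matrix.mulVec_zero]

lemma IsHausdorffPosDef.of_succ (hab : a < b) (h : IsHausdorffPosDef a b s (2 * n + 1)) :
    IsHausdorffPosDef a b s (2 * n) := by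
  obtain ⟨hK₁, hK₂⟩ := h.2.2 n rfl
  refine ⟨fun j hj => ?_, fun j hj => ?_, fun j hj => by omega⟩
  · obtain rfl : n = j := by omega
    exact posDef_H₁_of_posDef_K₁_of_posDef_K₂ hab hK₁ hK₂
  · obtain rfl : n = j + 1 := by omega
    exact posDef_H₂_of_posDef_K₁_of_posDef_K₂ hab hK₁ hK₂

lemma IsHausdorffPosDef.isRegular (hab : a < b) (h : IsHausdorffPosDef a b s (2 * n)) :
    IsRegular a b s n := by
  have hH₁ := h.1 n rfl
  have hH₂ (j : ℕ) (hj : j < n) : (H₂ a b s j).PosDef := by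
    obtain ⟨m, rfl⟩ := Nat.exists_eq_add_of_lt hj
    exact posDef_blockHankel_of_le (f := sHat a b s) (h.2.1 (j + m) rfl) (Nat.le_add_right _ _)
  refine ⟨fun k hk => isHermitian_of_blockHankel hH₁.isHermitian hk, fun j hj => ?_,
    fun j hj => (hH₂ j hj).isUnit⟩
  exact (posDef_K₁_of_posDef_H₁_of_posDef_H₂ hab (posDef_blockHankel_of_le hH₁ hj)
    (hH₂ j hj)).isUnit

end PosDef

end HausdorffMoment

end

open HausdorffMoment in
theorem proposition7p1_general {q n : ℕ} {a b : ℝ} {s : ℕ → Mat q} (h : IsRegular a b s n) :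
    (∀ j, j < n → IsUnit (mParam a b s j) ∧ IsUnit (lParam a b s j)) ∧
    (∀ j, j < n → Q₂ a b s j a = (-1) ^ j * (invProd a b s j * (mParam a b s j)⁻¹)) ∧
    (∀ j, j ≤ n → Γ₁ b s j a = (-1) ^ j * invProd a b s j) ∧
    (∀ j, j < n → P₂ a b s j a = (-1) ^ j * (invProd a b s j * (mParam a b s j)⁻¹ *
      ∑ k ∈ Finset.range (j + 1), mParam a b s k)) ∧
    (∀ j, j ≤ n → Θ₁ b s j a = (-1) ^ j * (invProd a b s j *
      (s 0 + ∑ k ∈ Finset.range j, lParam a b s k))) := by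
  have hQ₂ (j : ℕ) (hj : j < n) :
      Q₂ a b s j a = (-1) ^ j * (invProd a b s j * (mParam a b s j)⁻¹) := by
    rw [h.Q₂_eq_Γ₁_mul_inv hj, h.Γ₁_eq_invProd hj.le, mul_assoc]
  refine ⟨fun j hj => ⟨h.isUnit_mParam hj, h.isUnit_lParam hj⟩, hQ₂,
    fun j hj => h.Γ₁_eq_invProd hj, fun j hj => ?_, fun j hj => ?_⟩
  · rw [h.P₂_eq_Q₂_mul_sum hj, hQ₂ j hj, mul_assoc]
  · rw [h.Θ₁_eq_Γ₁_mul_add_sum hj, h.Γ₁_eq_invProd hj, mul_assoc]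

theorem proposition7p1 {q n : ℕ} (a b : ℝ) (hab : a < b)
    (s : ℕ → HausdorffMoment.Mat q)
    (hs : HausdorffMoment.IsHausdorffPosDef a b s (2 * n) ∨
      HausdorffMoment.IsHausdorffPosDef a b s (2 * n + 1)) :
    (∀ j, j < n → IsUnit (HausdorffMoment.mParam a b s j) ∧
      IsUnit (HausdorffMoment.lParam a b s j)) ∧
    (∀ j, j < n →
      HausdorffMoment.Q₂ a b s j a =
        (-1) ^ j * (HausdorffMoment.invProd a b s j * (HausdorffMoment.mParam a b s j)⁻¹)) ∧
    (∀ j, 1 ≤ j → j ≤ n →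
      HausdorffMoment.Γ₁ b s j a = (-1) ^ j * HausdorffMoment.invProd a b s j) ∧
    (∀ j, 1 ≤ j → j < n →
      HausdorffMoment.P₂ a b s j a =
        (-1) ^ j * (HausdorffMoment.invProd a b s j * (HausdorffMoment.mParam a b s j)⁻¹ *
          ∑ k ∈ Finset.range (j + 1), HausdorffMoment.mParam a b s k)) ∧
    (∀ j, 1 ≤ j → j ≤ n →
      HausdorffMoment.Θ₁ b s j a =
        (-1) ^ j * (HausdorffMoment.invProd a b s j *
          (s 0 + ∑ k ∈ Finset.range j, HausdorffMoment.lParam a b s k))) := by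
  obtain ⟨hml, hQ₂, hΓ₁, hP₂, hΘ₁⟩ := proposition7p1_general <|
    HausdorffMoment.IsHausdorffPosDef.isRegular hab (hs.elim id (.of_succ hab))
  exact ⟨hml, hQ₂, fun j _ => hΓ₁ j, fun j _ => hP₂ j, fun j _ => hΘ₁ j⟩
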